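/- Let $k$ be a field of characteristic $0$, let $\ell\ge 2$ be an integer with $\ell\neq 3$, and let $q\in k^\times$ be a primitive $\ell$-th root of unity. Let $$H_q = k\langle x,y,z\rangle/(zx-q\,xz,\ yz-q\,zy,\ xy-q\,yx-z^2)$$ be the quantum Heisenberg algebra. For a $k$-algebra $A$ with center $Z(A)$, let $\mathrm{Oz}(A)$ (the ozone group of $A$) be the group of all $k$-algebra automorphisms $\sigma$ of $A$ such that $\sigma(c)=c$ for all $c\in Z(A)$. Write $\mathbb{Z}_n$ for the cyclic group of order $n$. Then: 1. If $3\nmid \ell$, then $\mathrm{Oz}(H_q)\cong \mathbb{Z}_\ell$. 2. If $3\mid \ell$, then $\mathrm{Oz}(H_q)\cong \mathbb{Z}_\ell\times\mathbb{Z}_3$. -/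

import Mathlib

/-- The ozone group of a `k`-algebra `A`: the group of `k`-algebra automorphisms of `A` that fix
every element of the center of `A`. -/
def ozoneGroup (k A : Type*) [CommSemiring k] [Semiring A] [Algebra k A] :
    Subgroup (A ≃ₐ[k] A) where
  carrier := {σ | ∀ c ∈ Subalgebra.center k A, σ c = c}
  one_mem' := fun _ _ => rfl
  mul_mem' := by
    intro σ τ hσ hτ c hc
    rw [AlgEquiv.mul_apply, hτ c hc, hσ c hc]
  inv_mem' := by
    intro σ hσ c hc
    exact (AlgEquiv.symm_apply_eq σ).mpr (hσ c hc).symm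

namespace QuantumHeisenberg

/-- The three generators `x`, `y`, `z`. -/
inductive Gen : Type
  | x
  | y
  | z

/-- The defining relations `zx - q xz = 0`, `yz - q zy = 0`, `xy - q yx - z² = 0`
on the free algebra `k⟨x, y, z⟩`. -/
inductive Rel {k : Type*} [Field k] (q : k) : FreeAlgebra k Gen → FreeAlgebra k Gen → Prop
  | zx : Rel q (FreeAlgebra.ι k Gen.z * FreeAlgebra.ι k Gen.x
      - q • (FreeAlgebra.ι k Gen.x * FreeAlgebra.ι k Gen.z)) 0
  | yz : Rel q (FreeAlgebra.ι k Gen.y * FreeAlgebra.ι k Gen.z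
      - q • (FreeAlgebra.ι k Gen.z * FreeAlgebra.ι k Gen.y)) 0
  | xy : Rel q (FreeAlgebra.ι k Gen.x * FreeAlgebra.ι k Gen.y
      - q • (FreeAlgebra.ι k Gen.y * FreeAlgebra.ι k Gen.x) - FreeAlgebra.ι k Gen.z ^ 2) 0

end QuantumHeisenberg

/-- The quantum Heisenberg algebra
`H_q = k⟨x, y, z⟩ / (zx - q xz, yz - q zy, xy - q yx - z²)`. -/
abbrev QuantumHeisenberg {k : Type*} [Field k] (q : k) : Type _ :=
  RingQuot (QuantumHeisenberg.Rel q)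

/-! As `q ^ 3 ≠ 1`, a scalar a can be chosen so that w = yx + a z² is normal: zw = wz, xw = q wx, wy
= q yw. Hence H_q embeds in the skew Laurent ring k[Z, W][t^±1], where t scales Z by q⁻¹ and W by q,
through z ↦ Z, w ↦ W, x ↦ t, y ↦ (W - aZ²)t⁻¹ (`toSkew_injective`).

The elements x^ℓ, y^ℓ, z^ℓ and zw are central, so an ozone automorphism sends each generator to an
ℓ-th root of its ℓ-th power. Comparing extreme t-degrees, such a root is homogeneous, and then a
scalar multiple of the generator. So x, y, z are scaled by some α, β, γ; the relation for xy forces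
αβ = γ², and zw ↦ γ³zw forces γ³ = 1 (`exists_of_mem_ozoneGroup`).

Conversely, a central element only involves t-degrees divisible by ℓ and monomials Z^i W^j with ℓ ∣
j - i. If α^ℓ = γ^ℓ = γ³ = 1, these are fixed, as γ^(i+2j) = γ^(3j-(j-i)) = 1
(`diag_mem_ozoneGroup`). The group is therefore μ_ℓ × μ_gcd(ℓ,3). -/

namespace SkewMonoidAlgebra

/-! ### Extreme degrees and roots in skew group rings -/

variable {R G : Type*} [CommRing R] [CommGroup G] [MulSemiringAction G R]

/-- If `a` and `b` are of strictly maximal `v`-degree in `f` and `g`, then `a * b` is of strictly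
maximal `v`-degree in `f * g`. -/
theorem coeff_mul_of_forall_le {v : G →* Multiplicative ℤ} (hv : Function.Injective v)
    {f g : SkewMonoidAlgebra R G} {a b : G} (hf : ∀ e ∈ f.support, v e ≤ v a)
    (hg : ∀ e ∈ g.support, v e ≤ v b) :
    (f * g).coeff (a * b) = f.coeff a * a • g.coeff b := by
  classical
  have key : ∀ a₁ ∈ f.support, ∀ a₂ ∈ g.support, a₁ * a₂ = a * b → a₁ = a ∧ a₂ = b := by
    intro a₁ h₁ a₂ h₂ h
    have h' : v a₁ * v a₂ = v a * v b := by rw [← map_mul, h, map_mul]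
    have e₁ := (mul_eq_mul_iff_eq_and_eq (hf a₁ h₁) (hg a₂ h₂)).1 h'
    exact ⟨hv e₁.1, hv e₁.2⟩
  rw [coeff_mul, sum_def', Finset.sum_eq_single a]
  · rw [sum_def', Finset.sum_eq_single b]
    · simp
    · intro b' _ hb'
      rw [if_neg fun h => hb' (mul_left_cancel h)]
    · intro hb
      simp [notMem_support_iff.1 hb]
  · intro a₁ h₁ hne
    rw [sum_def']
    refine Finset.sum_eq_zero fun a₂ h₂ => ?_
    rw [if_neg fun h => hne (key a₁ h₁ a₂ h₂ h).1]
  · intro ha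
    rw [sum_def']
    simp [notMem_support_iff.1 ha]

variable [IsDomain R]

theorem coeff_pow_ne_zero_of_forall_le {v : G →* Multiplicative ℤ} (hv : Function.Injective v)
    {f : SkewMonoidAlgebra R G} {a : G} (hf : ∀ e ∈ f.support, v e ≤ v a) (ha : f.coeff a ≠ 0)
    (n : ℕ) : (f ^ n).coeff (a ^ n) ≠ 0 ∧ ∀ e ∈ (f ^ n).support, v e ≤ v (a ^ n) := by
  classical
  induction n with
  | zero =>
    refine ⟨by simp, fun e he => ?_⟩
    have : e = 1 := Finset.mem_one.1 (support_one_subset (pow_zero f ▸ he))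
    simp [this]
  | succ n ih =>
    rw [pow_succ, pow_succ]
    refine ⟨?_, fun e he => ?_⟩
    · rw [coeff_mul_of_forall_le hv ih.2 hf]
      exact mul_ne_zero ih.1 ((smul_ne_zero_iff_ne _).2 ha)
    · obtain ⟨b, hb, c, hc, rfl⟩ := Finset.mem_mul.1 (support_mul _ _ he)
      rw [map_mul, map_mul]
      exact mul_le_mul' (ih.2 b hb) (hf c hc)

/-- The order is carried by `v` so that one argument treats both the top degree (`v` the identity)
and the bottom degree (`v` inversion). -/
theorem eq_of_pow_eq_single {v : G →* Multiplicative ℤ} (hv : Function.Injective v)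
    {f : SkewMonoidAlgebra R G} {a g : G} (hf : ∀ e ∈ f.support, v e ≤ v a) (ha : f.coeff a ≠ 0)
    {n : ℕ} {r : R} (h : f ^ n = single g r) : a ^ n = g := by
  classical
  have := (coeff_pow_ne_zero_of_forall_le hv hf ha n).1
  rw [h, coeff_single_apply] at this
  by_contra hne
  exact this (if_neg fun h => hne h.symm)


/-- A root of a homogeneous element of a skew Laurent polynomial ring over a domain is
homogeneous. -/
theorem exists_eq_single_of_pow_eq_single [MulSemiringAction (Multiplicative ℤ) R]
    {f : SkewMonoidAlgebra R (Multiplicative ℤ)} {n : ℕ}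
    (hn : n ≠ 0) {g : Multiplicative ℤ} {r : R} (hr : r ≠ 0) (h : f ^ n = single g r) :
    ∃ a s, a ^ n = g ∧ f = single a s := by
  classical
  have hf : f ≠ 0 := by
    rintro rfl
    rw [zero_pow hn] at h
    exact hr (single_eq_zero.1 h.symm)
  have hs : f.support.Nonempty := Finset.nonempty_iff_ne_empty.2 fun h => hf (support_eq_empty.1 h)
  obtain ⟨a, ha, hamax⟩ := Finset.exists_max_image f.support id hs
  obtain ⟨b, hb, hbmin⟩ := Finset.exists_min_image f.support id hs
  have h₁ : a ^ n = g := eq_of_pow_eq_single (v := MonoidHom.id _) Function.injective_id hamax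
    (mem_support_iff.1 ha) h
  have h₂ : b ^ n = g := eq_of_pow_eq_single (v := invMonoidHom) inv_injective
    (fun e he => by simpa using hbmin e he) (mem_support_iff.1 hb) h
  -- Top and bottom degree have the same n-th power, and ℤ is torsion-free.
  have hab : a = b := pow_left_injective hn (h₁.trans h₂.symm)
  refine ⟨a, f.coeff a, h₁, ext fun e => ?_⟩
  rw [coeff_single_apply]
  split_ifs with he
  · rw [he]
  · refine notMem_support_iff.1 fun hm => he (le_antisymm ?_ (hamax e hm))
    rw [hab]
    exact hbmin e hm

/-- The coefficient is a product of twists of `r`; only its nonvanishing is needed. -/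
theorem exists_single_pow_eq (a : G) (r : R) (n : ℕ) :
    ∃ s, (r ≠ 0 → s ≠ 0) ∧ single a r ^ n = single (a ^ n) s := by
  induction n with
  | zero => exact ⟨1, fun _ => one_ne_zero, by rw [pow_zero, pow_zero, one_def]⟩
  | succ n ih =>
    obtain ⟨s, hs, h⟩ := ih
    refine ⟨s * a ^ n • r, fun hr => mul_ne_zero (hs hr) ((smul_ne_zero_iff_ne _).2 hr), ?_⟩
    rw [pow_succ, h, single_mul_single, pow_succ]

end SkewMonoidAlgebra

/-! ### Diagonal scalings of a polynomial ring -/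

namespace MvPolynomial

variable {σ k : Type*} [CommSemiring k]

/-- The endomorphism of a polynomial ring multiplying each variable by a scalar. -/
noncomputable def scaleVars (s : σ → k) : MvPolynomial σ k →ₐ[k] MvPolynomial σ k :=
  aeval fun i => C (s i) * X i

theorem scaleVars_X (s : σ → k) (i : σ) : scaleVars s (X i) = C (s i) * X i := by
  simp [scaleVars]

theorem scaleVars_scaleVars (s t : σ → k) (f : MvPolynomial σ k) :
    scaleVars s (scaleVars t f) = scaleVars (s * t) f := by
  rw [← AlgHom.comp_apply]
  congr 1
  ext i : 1
  simp only [AlgHom.comp_apply, scaleVars_X, map_mul, Pi.mul_apply, algHom_C, algebraMap_eq]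
  ring

theorem scaleVars_one (f : MvPolynomial σ k) : scaleVars (1 : σ → k) f = f := by
  have : scaleVars (1 : σ → k) = AlgHom.id k _ := by
    ext i : 1
    simp [scaleVars_X]
  rw [this, AlgHom.id_apply]

theorem coeff_scaleVars (s : σ → k) (f : MvPolynomial σ k) (m : σ →₀ ℕ) :
    coeff m (scaleVars s f) = (m.prod fun i e => s i ^ e) * coeff m f := by
  classical
  induction f using MvPolynomial.induction_on' with
  | monomial n c =>
    have : scaleVars s (monomial n c) = monomial n ((n.prod fun i e => s i ^ e) * c) := by
      rw [scaleVars, aeval_monomial, monomial_eq, map_mul, map_finsuppProd]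
      simp only [mul_pow, Finsupp.prod_mul, algebraMap_eq, map_pow]
      ring
    rw [this, coeff_monomial, coeff_monomial]
    split_ifs with h
    · rw [h]
    · simp
  | add p q hp hq => rw [map_add, coeff_add, coeff_add, hp, hq, mul_add]

end MvPolynomial

/-! ### Presentation, universal property and the x–y symmetry -/

namespace QuantumHeisenberg

section Presentation

variable {k : Type*} [Field k] (q : k)

/-- The image of a generator in the quantum Heisenberg algebra. -/
noncomputable def gen (i : Gen) : QuantumHeisenberg q :=
  RingQuot.mkAlgHom k (Rel q) (FreeAlgebra.ι k i)

theorem gen_z_mul_gen_x : gen q .z * gen q .x = q • (gen q .x * gen q .z) := by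
  have := RingQuot.mkAlgHom_rel k (Rel.zx (q := q))
  rwa [map_zero, map_sub, map_smul, map_mul, map_mul, sub_eq_zero] at this

theorem gen_y_mul_gen_z : gen q .y * gen q .z = q • (gen q .z * gen q .y) := by
  have := RingQuot.mkAlgHom_rel k (Rel.yz (q := q))
  rwa [map_zero, map_sub, map_smul, map_mul, map_mul, sub_eq_zero] at this

theorem gen_x_mul_gen_y :
    gen q .x * gen q .y = q • (gen q .y * gen q .x) + gen q .z ^ 2 := by
  have := RingQuot.mkAlgHom_rel k (Rel.xy (q := q))
  rw [map_zero, map_sub, map_sub, map_smul, map_mul, map_mul, map_pow, sub_sub, sub_eq_zero] at this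
  exact this

variable {q}

/-- The universal property of the quantum Heisenberg algebra. -/
noncomputable def lift {A : Type*} [Ring A] [Algebra k A] (f : Gen → A)
    (hzx : f .z * f .x = q • (f .x * f .z)) (hyz : f .y * f .z = q • (f .z * f .y))
    (hxy : f .x * f .y = q • (f .y * f .x) + f .z ^ 2) : QuantumHeisenberg q →ₐ[k] A :=
  RingQuot.liftAlgHom k ⟨FreeAlgebra.lift k f, by
    rintro _ _ (_ | _ | _)
    · simp [hzx]
    · simp [hyz]
    · simp [hxy]⟩

@[simp]
theorem lift_gen {A : Type*} [Ring A] [Algebra k A] (f : Gen → A) (hzx) (hyz) (hxy) (i : Gen) :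
    lift (q := q) f hzx hyz hxy (gen q i) = f i := by
  rw [lift, gen, RingQuot.liftAlgHom_mkAlgHom_apply, FreeAlgebra.lift_ι_apply]

theorem algHom_ext {A : Type*} [Semiring A] [Algebra k A] {f g : QuantumHeisenberg q →ₐ[k] A}
    (h : ∀ i, f (gen q i) = g (gen q i)) : f = g := by
  apply RingQuot.ringQuot_ext'
  ext i
  exact h i

theorem submodule_eq_top {p : Submodule k (QuantumHeisenberg q)} (h1 : 1 ∈ p)
    (hmul : ∀ i, ∀ m ∈ p, gen q i * m ∈ p) : p = ⊤ := by
  have key (a : FreeAlgebra k Gen) : ∀ m ∈ p, RingQuot.mkAlgHom k (Rel q) a * m ∈ p := by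
    induction a with
    | grade0 r =>
      intro m hm
      rw [AlgHom.commutes, ← Algebra.smul_def]
      exact p.smul_mem r hm
    | grade1 i => exact hmul i
    | mul a b ha hb =>
      intro m hm
      rw [map_mul, mul_assoc]
      exact ha _ (hb m hm)
    | add a b ha hb =>
      intro m hm
      rw [map_add, add_mul]
      exact p.add_mem (ha m hm) (hb m hm)
  refine eq_top_iff.2 fun h _ => ?_
  obtain ⟨a, rfl⟩ := RingQuot.mkAlgHom_surjective k (Rel q) h
  simpa using key a 1 h1

theorem mem_center_of_forall_gen {c : QuantumHeisenberg q} (h : ∀ i, gen q i * c = c * gen q i) :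
    c ∈ Subalgebra.center k (QuantumHeisenberg q) := by
  rw [Subalgebra.mem_center_iff]
  intro b
  obtain ⟨a, rfl⟩ := RingQuot.mkAlgHom_surjective k (Rel q) b
  induction a with
  | grade0 r => rw [AlgHom.commutes, Algebra.commutes]
  | grade1 i => exact h i
  | mul a b ha hb => rw [map_mul, mul_assoc, hb, ← mul_assoc, ha, mul_assoc]
  | add a b ha hb => rw [map_add, add_mul, mul_add, ha, hb]

open MulOpposite in
variable (q) in
/-- The anti-automorphism of the quantum Heisenberg algebra exchanging `x` and `y`. -/
noncomputable def swap : QuantumHeisenberg q →ₐ[k] (QuantumHeisenberg q)ᵐᵒᵖ :=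
  lift (fun | .x => op (gen q .y) | .y => op (gen q .x) | .z => op (gen q .z))
    (by simp only [← op_mul, ← op_smul, gen_y_mul_gen_z])
    (by simp only [← op_mul, ← op_smul, gen_z_mul_gen_x])
    (by simp only [← op_mul, ← op_smul, ← op_pow, ← op_add, gen_x_mul_gen_y])

open MulOpposite

@[simp] theorem swap_x : swap q (gen q .x) = op (gen q .y) := lift_gen _ _ _ _ _
@[simp] theorem swap_y : swap q (gen q .y) = op (gen q .x) := lift_gen _ _ _ _ _
@[simp] theorem swap_z : swap q (gen q .z) = op (gen q .z) := lift_gen _ _ _ _ _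

theorem unop_swap_unop_swap (h : QuantumHeisenberg q) : unop (swap q (unop (swap q h))) = h := by
  obtain ⟨a, rfl⟩ := RingQuot.mkAlgHom_surjective k (Rel q) h
  induction a with
  | grade0 r => simp
  | grade1 i =>
    change unop (swap q (unop (swap q (gen q i)))) = gen q i
    cases i <;> simp
  | mul a b ha hb => simp only [map_mul, unop_mul, ha, hb]
  | add a b ha hb => simp only [map_add, unop_add, ha, hb]

theorem unop_swap_mem_center {c : QuantumHeisenberg q}
    (hc : c ∈ Subalgebra.center k (QuantumHeisenberg q)) :
    unop (swap q c) ∈ Subalgebra.center k (QuantumHeisenberg q) := by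
  rw [Subalgebra.mem_center_iff] at hc ⊢
  intro b
  rw [← unop_swap_unop_swap b, ← unop_mul, ← unop_mul, ← map_mul, ← map_mul, hc]

end Presentation

/-! ### The skew Laurent model -/

section Model

variable {k : Type*} [Field k]

/-- The polynomial ring in two variables `Z` and `W`, on which the generator of `ℤ` acts by
`Z ↦ q⁻¹ Z` and `W ↦ q W`. -/
def Coeff (_q : kˣ) : Type _ := MvPolynomial (Fin 2) k

variable (q : kˣ)

noncomputable instance : CommRing (Coeff q) := inferInstanceAs (CommRing (MvPolynomial (Fin 2) k))
noncomputable instance : Algebra k (Coeff q) :=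
  inferInstanceAs (Algebra k (MvPolynomial (Fin 2) k))
instance : IsDomain (Coeff q) := inferInstanceAs (IsDomain (MvPolynomial (Fin 2) k))

/-- The scalars by which `n : ℤ` acts on the variables of `Coeff q`. -/
def weight (n : ℤ) : Fin 2 → k := ![((q ^ (-n) : kˣ) : k), ((q ^ n : kˣ) : k)]

theorem weight_zero : weight q 0 = 1 := by
  ext i; fin_cases i <;> simp [weight]

theorem weight_add (m n : ℤ) : weight q (m + n) = weight q m * weight q n := by
  ext i; fin_cases i <;> simp [weight, zpow_add, mul_comm]

variable {q} in
/-- The endomorphism of `Coeff q` multiplying the variables by scalars. -/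
noncomputable def Coeff.scale (s : Fin 2 → k) : Coeff q →ₐ[k] Coeff q := MvPolynomial.scaleVars s

theorem Coeff.scale_scale (s t : Fin 2 → k) (f : Coeff q) :
    Coeff.scale s (Coeff.scale t f) = Coeff.scale (s * t) f := MvPolynomial.scaleVars_scaleVars s t f

theorem Coeff.scale_one (f : Coeff q) : Coeff.scale 1 f = f := MvPolynomial.scaleVars_one f

noncomputable instance : MulSemiringAction (Multiplicative ℤ) (Coeff q) where
  smul n f := Coeff.scale (weight q n.toAdd) f
  one_smul f := by
    change Coeff.scale (weight q 0) f = f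
    rw [weight_zero, Coeff.scale_one]
  mul_smul m n f := by
    change Coeff.scale (weight q (m.toAdd + n.toAdd)) f = Coeff.scale _ (Coeff.scale _ f)
    rw [Coeff.scale_scale, weight_add]
  smul_zero n := map_zero (Coeff.scale (weight q n.toAdd))
  smul_add n := map_add (Coeff.scale (weight q n.toAdd))
  smul_one n := map_one (Coeff.scale (weight q n.toAdd))
  smul_mul n := map_mul (Coeff.scale (weight q n.toAdd))

theorem ofAdd_smul (n : ℤ) (f : Coeff q) :
    Multiplicative.ofAdd n • f = Coeff.scale (weight q n) f := rfl

instance : SMulCommClass (Multiplicative ℤ) k (Coeff q) where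
  smul_comm n c f := map_smul (Coeff.scale (weight q n.toAdd)) c f

/-- The variable `Z`. -/
noncomputable def Coeff.Z : Coeff q := MvPolynomial.X (0 : Fin 2)

/-- The variable `W`. -/
noncomputable def Coeff.W : Coeff q := MvPolynomial.X (1 : Fin 2)

theorem Coeff.scale_Z (s : Fin 2 → k) : Coeff.scale s (Coeff.Z q) = s 0 • Coeff.Z q :=
  (MvPolynomial.scaleVars_X _ _).trans (MvPolynomial.C_mul' ..)

theorem Coeff.scale_W (s : Fin 2 → k) : Coeff.scale s (Coeff.W q) = s 1 • Coeff.W q :=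
  (MvPolynomial.scaleVars_X _ _).trans (MvPolynomial.C_mul' ..)

theorem smul_Z (n : Multiplicative ℤ) : n • Coeff.Z q = ((q ^ (-n.toAdd) : kˣ) : k) • Coeff.Z q :=
  Coeff.scale_Z q _

theorem smul_W (n : Multiplicative ℤ) : n • Coeff.W q = ((q ^ n.toAdd : kˣ) : k) • Coeff.W q :=
  Coeff.scale_W q _

theorem Coeff.Z_ne_zero : Coeff.Z q ≠ 0 := MvPolynomial.X_ne_zero _
theorem Coeff.W_ne_zero : Coeff.W q ≠ 0 := MvPolynomial.X_ne_zero _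

/-- The scalar `a` such that `yx + a z²` is a normal element. -/
def normalCoeff : k := (q : k) ^ 2 / ((q : k) ^ 3 - 1)

/-- The polynomial in `Z` and `W` representing `yx`. -/
noncomputable def Coeff.T : Coeff q := Coeff.W q - normalCoeff q • Coeff.Z q ^ 2

theorem Coeff.T_ne_zero : Coeff.T q ≠ 0 := by
  intro h
  have h' : MvPolynomial.X (1 : Fin 2) - MvPolynomial.C (normalCoeff q) * MvPolynomial.X 0 ^ 2 = 0 := by
    rw [MvPolynomial.C_mul']
    exact h
  have := congrArg (MvPolynomial.eval ![(0 : k), 1]) h'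
  simp at this

variable {q}

/-- This is the comparison of xz² terms in xw = q wx, using z²x = q² xz². -/
theorem normalCoeff_spec (hq : (q : k) ^ 3 ≠ 1) :
    normalCoeff q * (q : k) ^ 3 = normalCoeff q + (q : k) ^ 2 := by
  have : (q : k) ^ 3 - 1 ≠ 0 := sub_ne_zero.2 hq
  rw [normalCoeff]
  field_simp
  ring

/-- In the model yx is T and xy is its twist by t, so this is the relation xy = q yx + z². -/
theorem smul_T (hq : (q : k) ^ 3 ≠ 1) :
    Multiplicative.ofAdd (1 : ℤ) • Coeff.T q = (q : k) • Coeff.T q + Coeff.Z q ^ 2 := by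
  rw [Coeff.T, smul_sub, smul_comm, smul_pow', smul_Z, smul_W, smul_pow, smul_sub, smul_smul,
    smul_smul]
  have : normalCoeff q * ((q ^ (-(1 : ℤ)) : kˣ) : k) ^ 2 = q * normalCoeff q - 1 := by
    have h := normalCoeff_spec hq
    have h0 : (q : k) ≠ 0 := q.ne_zero
    simp
    field_simp
    linear_combination -h
  simp only [toAdd_ofAdd, zpow_one]
  rw [this, sub_smul, one_smul]
  abel

open SkewMonoidAlgebra Multiplicative

variable (q) in
/-- The skew Laurent polynomial ring in which the quantum Heisenberg algebra embeds. -/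
abbrev Skew : Type _ := SkewMonoidAlgebra (Coeff q) (Multiplicative ℤ)

/-- The embedding of the quantum Heisenberg algebra in a skew Laurent polynomial ring. -/
noncomputable def toSkew (hq : (q : k) ^ 3 ≠ 1) : QuantumHeisenberg (q : k) →ₐ[k] Skew q :=
  lift (fun | .x => single (ofAdd 1) 1 | .y => single (ofAdd (-1)) (Coeff.T q)
            | .z => single 1 (Coeff.Z q))
    (by
      simp only [single_mul_single, smul_single]
      simp [smul_Z, smul_smul])
    (by
      simp only [single_mul_single, smul_single]
      simp [smul_Z, mul_comm])
    (by
      simp only [single_mul_single, smul_single, pow_two]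
      rw [smul_T hq]
      simp [pow_two, single_add])

variable (hq : (q : k) ^ 3 ≠ 1)

@[simp] theorem toSkew_x : toSkew hq (gen _ .x) = single (ofAdd 1) 1 := lift_gen _ _ _ _ _
@[simp] theorem toSkew_y : toSkew hq (gen _ .y) = single (ofAdd (-1)) (Coeff.T q) :=
  lift_gen _ _ _ _ _
@[simp] theorem toSkew_z : toSkew hq (gen _ .z) = single 1 (Coeff.Z q) := lift_gen _ _ _ _ _

end Model

end QuantumHeisenberg

/-! ### Commuting pairs and the normal element -/

open scoped IsMulCommutative in
theorem MvPolynomial.exists_algHom_of_commute {k A : Type*} [CommRing k] [Ring A] [Algebra k A]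
    {a b : A} (h : Commute a b) :
    ∃ f : MvPolynomial (Fin 2) k →ₐ[k] A, f (X 0) = a ∧ f (X 1) = b := by
  have hc : ∀ x ∈ ({a, b} : Set A), ∀ y ∈ ({a, b} : Set A), x * y = y * x := by
    rintro x (rfl | rfl) y (rfl | rfl)
    exacts [rfl, h, h.symm, rfl]
  have := Algebra.isMulCommutative_adjoin k hc
  let a' : Algebra.adjoin k ({a, b} : Set A) := ⟨a, Algebra.subset_adjoin (by simp)⟩
  let b' : Algebra.adjoin k ({a, b} : Set A) := ⟨b, Algebra.subset_adjoin (by simp)⟩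
  refine ⟨(Subalgebra.val _).comp (aeval ![a', b']), ?_, ?_⟩ <;> simp [a', b']

namespace QuantumHeisenberg

open SkewMonoidAlgebra Multiplicative

section

variable {k : Type*} [Field k] {q : kˣ}

/-- Intertwining relations need only be checked on Z and W. With `a = 1` this says that
homomorphisms agreeing there are equal. -/
theorem Coeff.semiconj {A : Type*} [Ring A] [Algebra k A] (f g : Coeff q →ₐ[k] A) {a : A}
    (hZ : a * f (Coeff.Z q) = g (Coeff.Z q) * a) (hW : a * f (Coeff.W q) = g (Coeff.W q) * a)
    (p : Coeff q) : a * f p = g p * a := by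
  have hmul : ∀ p r : Coeff q, a * f p = g p * a → a * f r = g r * a →
      a * f (p * r) = g (p * r) * a := by
    intro p r h hr
    rw [map_mul, map_mul, ← mul_assoc, h, mul_assoc, hr, mul_assoc]
  have hadd : ∀ p r : Coeff q, a * f p = g p * a → a * f r = g r * a →
      a * f (p + r) = g (p + r) * a := by
    intro p r h hr
    rw [map_add, map_add, mul_add, add_mul, h, hr]
  refine MvPolynomial.induction_on (motive := fun p : Coeff q => a * f p = g p * a) p
    (fun r => ?_) hadd (fun p i h => hmul p _ h ?_)
  · exact (congrArg (a * ·) (f.commutes r)).trans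
      ((Algebra.commutes r a).symm.trans (congrArg (· * a) (g.commutes r)).symm)
  · fin_cases i
    exacts [hZ, hW]

theorem Coeff.exists_eq_algebraMap_of_isUnit {c : Coeff q} (hc : IsUnit c) :
    ∃ r : k, c = algebraMap k (Coeff q) r := by
  obtain ⟨r, -, h⟩ := MvPolynomial.isUnit_iff_eq_C_of_isReduced.1 hc
  exact ⟨r, h⟩

variable (q)

local notation "𝐱" => gen (q : k) Gen.x
local notation "𝐲" => gen (q : k) Gen.y
local notation "𝐳" => gen (q : k) Gen.z

/-- The normal element `w = yx + a z²`. -/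
noncomputable def normalElt : QuantumHeisenberg (q : k) := 𝐲 * 𝐱 + normalCoeff q • 𝐳 ^ 2

theorem sq_z_mul_x : 𝐳 ^ 2 * 𝐱 = (q : k) ^ 2 • (𝐱 * 𝐳 ^ 2) := by
  rw [pow_two, mul_assoc, gen_z_mul_gen_x, mul_smul_comm, ← mul_assoc, gen_z_mul_gen_x,
    smul_mul_assoc, smul_smul, mul_assoc, pow_two]

theorem y_mul_sq_z : 𝐲 * 𝐳 ^ 2 = (q : k) ^ 2 • (𝐳 ^ 2 * 𝐲) := by
  rw [pow_two, ← mul_assoc, gen_y_mul_gen_z, smul_mul_assoc, mul_assoc, gen_y_mul_gen_z,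
    mul_smul_comm, smul_smul, ← mul_assoc, pow_two]

theorem z_mul_normalElt : Commute 𝐳 (normalElt q) := by
  have h : 𝐳 * (𝐲 * 𝐱) = 𝐲 * 𝐱 * 𝐳 := by
    have h₁ : (q : k) • (𝐳 * (𝐲 * 𝐱)) = (q : k) • (𝐲 * 𝐱 * 𝐳) := by
      rw [← mul_assoc, ← smul_mul_assoc, ← gen_y_mul_gen_z, mul_assoc, gen_z_mul_gen_x,
        mul_smul_comm, mul_assoc]
    exact smul_right_injective _ q.ne_zero h₁
  rw [Commute, SemiconjBy, normalElt, mul_add, add_mul, h, mul_smul_comm, smul_mul_assoc,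
    ← pow_succ, ← pow_succ']

variable {q}
variable (hq : (q : k) ^ 3 ≠ 1)
include hq

theorem x_mul_normalElt : 𝐱 * normalElt q = (q : k) • (normalElt q * 𝐱) := by
  have h := normalCoeff_spec hq
  rw [normalElt, mul_add, add_mul, ← mul_assoc, gen_x_mul_gen_y, add_mul, mul_smul_comm,
    smul_mul_assoc, smul_mul_assoc, sq_z_mul_x]
  match_scalars
  · ring
  · linear_combination -h

theorem normalElt_mul_y : normalElt q * 𝐲 = (q : k) • (𝐲 * normalElt q) := by
  have h := normalCoeff_spec hq
  rw [normalElt, mul_add, add_mul, mul_assoc, gen_x_mul_gen_y, mul_add, mul_smul_comm,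
    smul_mul_assoc, mul_smul_comm, y_mul_sq_z, ← mul_assoc]
  match_scalars
  · ring
  · linear_combination -h

end

end QuantumHeisenberg

/-! ### Normal forms and injectivity of the embedding -/

namespace QuantumHeisenberg

open SkewMonoidAlgebra Multiplicative

section

variable {k : Type*} [Field k] (q : kˣ)

local notation "𝐱" => gen (q : k) Gen.x
local notation "𝐲" => gen (q : k) Gen.y
local notation "𝐳" => gen (q : k) Gen.z

/-- The embedding of `Coeff q` in the quantum Heisenberg algebra. -/
noncomputable def coeffHom : Coeff q →ₐ[k] QuantumHeisenberg (q : k) :=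
  (MvPolynomial.exists_algHom_of_commute (z_mul_normalElt q)).choose

theorem coeffHom_Z : coeffHom q (Coeff.Z q) = 𝐳 :=
  (MvPolynomial.exists_algHom_of_commute (z_mul_normalElt q)).choose_spec.1

theorem coeffHom_W : coeffHom q (Coeff.W q) = normalElt q :=
  (MvPolynomial.exists_algHom_of_commute (z_mul_normalElt q)).choose_spec.2

theorem coeffHom_T : coeffHom q (Coeff.T q) = 𝐲 * 𝐱 := by
  rw [Coeff.T, map_sub, map_smul, map_pow, coeffHom_Z, coeffHom_W, normalElt, add_sub_cancel_right]

/-- The elements `x ^ d` for `d ≥ 0` and `y ^ |d|` for `d < 0`. -/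
noncomputable def extremal : ℤ → QuantumHeisenberg (q : k)
  | .ofNat n => 𝐱 ^ n
  | .negSucc n => 𝐲 ^ (n + 1)

/-- The map sending `∑ f_d t ^ d` to `∑ f_d x_d`, where `x_d` is `x ^ d` or `y ^ |d|`. -/
noncomputable def normalForm : (ℤ →₀ Coeff q) →ₗ[k] QuantumHeisenberg (q : k) :=
  Finsupp.lsum k fun d => LinearMap.mulRight k (extremal q d) ∘ₗ (coeffHom q).toLinearMap

variable {q}

theorem normalForm_single (d : ℤ) (f : Coeff q) :
    normalForm q (Finsupp.single d f) = coeffHom q f * extremal q d := by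
  simp [normalForm]

variable (hq : (q : k) ^ 3 ≠ 1)
include hq

theorem x_mul_coeffHom (f : Coeff q) :
    𝐱 * coeffHom q f = coeffHom q (ofAdd (1 : ℤ) • f) * 𝐱 := by
  rw [ofAdd_smul, ← AlgHom.comp_apply]
  refine Coeff.semiconj _ _ ?_ ?_ f
  · rw [AlgHom.comp_apply, ← ofAdd_smul, smul_Z, map_smul, coeffHom_Z, smul_mul_assoc,
      gen_z_mul_gen_x, smul_smul]
    simp
  · rw [AlgHom.comp_apply, ← ofAdd_smul, smul_W, map_smul, coeffHom_W, x_mul_normalElt hq,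
      smul_mul_assoc]
    simp

theorem y_mul_coeffHom (f : Coeff q) :
    𝐲 * coeffHom q f = coeffHom q (ofAdd (-1 : ℤ) • f) * 𝐲 := by
  rw [ofAdd_smul, ← AlgHom.comp_apply]
  refine Coeff.semiconj _ _ ?_ ?_ f
  · rw [AlgHom.comp_apply, ← ofAdd_smul, smul_Z, map_smul, coeffHom_Z, smul_mul_assoc,
      gen_y_mul_gen_z]
    simp
  · rw [AlgHom.comp_apply, ← ofAdd_smul, smul_W, map_smul, coeffHom_W, smul_mul_assoc,
      normalElt_mul_y hq, smul_smul]
    simp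

theorem x_mul_y_eq : 𝐱 * 𝐲 = coeffHom q (ofAdd (1 : ℤ) • Coeff.T q) := by
  rw [smul_T hq, map_add, map_smul, map_pow, coeffHom_T, coeffHom_Z, gen_x_mul_gen_y]

/-- The range contains 1 and is stable under left multiplication by generators: x and y move past
coefficients with a twist, and xy and yx are themselves coefficients. -/
theorem range_normalForm : LinearMap.range (normalForm q) = ⊤ := by
  have hx (f : Coeff q) (n : ℕ) : coeffHom q f * 𝐱 ^ n ∈ LinearMap.range (normalForm q) :=
    ⟨Finsupp.single (.ofNat n) f, normalForm_single _ _⟩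
  have hy (f : Coeff q) (n : ℕ) : coeffHom q f * 𝐲 ^ n ∈ LinearMap.range (normalForm q) := by
    cases n with
    | zero => simpa using hx f 0
    | succ n => exact ⟨Finsupp.single (.negSucc n) f, normalForm_single _ _⟩
  refine submodule_eq_top (by simpa using hx 1 0) ?_
  rintro i _ ⟨c, rfl⟩
  induction c using Finsupp.induction_linear with
  | zero => simp
  | add c d hc hd =>
    rw [map_add, mul_add]
    exact add_mem hc hd
  | single d f =>
    rw [normalForm_single]
    cases i with
    | x =>
      rw [← mul_assoc, x_mul_coeffHom hq, mul_assoc]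
      rcases d with n | n
      · rw [extremal, ← pow_succ']
        exact hx _ _
      · rw [extremal, pow_succ', ← mul_assoc (gen _ _), x_mul_y_eq hq, ← mul_assoc, ← map_mul]
        exact hy _ _
    | y =>
      rw [← mul_assoc, y_mul_coeffHom hq, mul_assoc]
      rcases d with n | n
      · rw [extremal]
        cases n with
        | zero =>
          -- Here multiplication by y crosses from degree 0 to degree -1, so nothing cancels.
          rw [pow_zero, mul_one, ← pow_one (gen _ .y)]
          exact hy _ _
        | succ n =>
          rw [pow_succ', ← mul_assoc (gen _ _), ← coeffHom_T, ← mul_assoc, ← map_mul]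
          exact hx _ _
      · rw [extremal, ← pow_succ']
        exact hy _ _
    | z =>
      rw [← coeffHom_Z, ← mul_assoc, ← map_mul]
      exact ⟨Finsupp.single d _, normalForm_single _ _⟩

theorem toSkew_normalElt : toSkew hq (normalElt q) = single 1 (Coeff.W q) := by
  rw [normalElt, map_add, map_mul, map_smul, map_pow, toSkew_x, toSkew_y, toSkew_z, pow_two]
  simp only [single_mul_single, smul_single, ← ofAdd_add, Coeff.T]
  simp [← single_add, pow_two]

theorem toSkew_coeffHom (f : Coeff q) : toSkew hq (coeffHom q f) = single 1 f := by
  let g : Coeff q →ₐ[k] Skew q := { singleOneRingHom with commutes' := fun r => rfl }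
  have := Coeff.semiconj ((toSkew hq).comp (coeffHom q)) g (a := 1)
    (by simp [coeffHom_Z, g, singleOneRingHom])
    (by simp [coeffHom_W, g, singleOneRingHom, toSkew_normalElt]) f
  simpa [g, singleOneRingHom] using this

theorem exists_toSkew_extremal (d : ℤ) :
    ∃ t ≠ 0, toSkew hq (extremal q d) = single (ofAdd d) t := by
  rcases d with n | n
  · obtain ⟨s, hs, h⟩ := exists_single_pow_eq (ofAdd (1 : ℤ)) (1 : Coeff q) n
    refine ⟨s, hs one_ne_zero, ?_⟩
    rw [extremal, map_pow, toSkew_x, h, ← ofAdd_nsmul]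
    simp
  · obtain ⟨s, hs, h⟩ := exists_single_pow_eq (ofAdd (-1 : ℤ)) (Coeff.T q) (n + 1)
    refine ⟨s, hs (Coeff.T_ne_zero q), ?_⟩
    rw [extremal, map_pow, toSkew_y, h, ← ofAdd_nsmul, Int.negSucc_eq]
    simp

/-- Every element has a normal form, and its degree d coefficient reappears in the image multiplied
by a nonzero `t d`. -/
theorem toSkew_injective : Function.Injective (toSkew hq) := by
  classical
  rw [injective_iff_map_eq_zero]
  intro h h0
  obtain ⟨c, rfl⟩ : h ∈ LinearMap.range (normalForm q) := range_normalForm hq ▸ Submodule.mem_top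
  choose t ht0 ht using exists_toSkew_extremal hq
  have key (c : ℤ →₀ Coeff q) (d : ℤ) :
      (toSkew hq (normalForm q c)).coeff (ofAdd d) = c d * t d := by
    induction c using Finsupp.induction_linear with
    | zero => simp
    | add c₁ c₂ h₁ h₂ => simp [h₁, h₂, add_mul]
    | single e f =>
      rw [normalForm_single, map_mul, toSkew_coeffHom, ht, single_mul_single, one_mul, one_smul,
        coeff_single_apply, Finsupp.single_apply]
      by_cases h : e = d
      · subst h; simp
      · simp [h]
  have : c = 0 := by
    ext d
    have := key c d
    rw [h0, coeff_zero, Finsupp.zero_apply, eq_comm, mul_eq_zero] at this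
    exact this.resolve_right (ht0 d)
  rw [this, map_zero]

/-! ### Roots of the ℓ-th powers of the generators -/

theorem toSkew_x_pow (n : ℕ) : toSkew hq (𝐱 ^ n) = single (ofAdd (n : ℤ)) 1 := by
  rw [map_pow, toSkew_x, ← of_apply, ← map_pow, of_apply, ← ofAdd_nsmul]
  simp

theorem toSkew_z_pow (n : ℕ) : toSkew hq (𝐳 ^ n) = single 1 (Coeff.Z q ^ n) := by
  rw [← coeffHom_Z, ← map_pow, toSkew_coeffHom]

theorem exists_eq_smul_x {ℓ : ℕ} (hℓ : ℓ ≠ 0) {v : QuantumHeisenberg (q : k)}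
    (hv : v ^ ℓ = 𝐱 ^ ℓ) : ∃ r : k, r ^ ℓ = 1 ∧ v = r • 𝐱 := by
  have h : toSkew hq v ^ ℓ = single (ofAdd (ℓ : ℤ)) 1 := by rw [← map_pow, hv, toSkew_x_pow]
  obtain ⟨a, s, ha, hs⟩ := exists_eq_single_of_pow_eq_single hℓ one_ne_zero h
  obtain rfl : a = ofAdd 1 := by
    refine pow_left_injective hℓ (ha.trans ?_)
    change _ = ofAdd (1 : ℤ) ^ ℓ
    rw [← ofAdd_nsmul]
    simp
  -- The twisted product of ℓ factors starting with `s` is 1, so `s` is a unit, hence a constant.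
  have hsu : IsUnit s := by
    obtain ⟨n, rfl⟩ := Nat.exists_eq_succ_of_ne_zero hℓ
    obtain ⟨t, -, ht⟩ := exists_single_pow_eq (ofAdd (1 : ℤ)) s n
    rw [hs, pow_succ', ht, single_mul_single, ← pow_succ', ha] at h
    exact .of_mul_eq_one _ (single_injective _ h)
  obtain ⟨r, rfl⟩ := Coeff.exists_eq_algebraMap_of_isUnit hsu
  have hvr : v = r • 𝐱 := by
    apply toSkew_injective hq
    rw [hs, map_smul, toSkew_x, smul_single, Algebra.algebraMap_eq_smul_one]
  refine ⟨r, ?_, hvr⟩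
  rw [hvr, smul_pow] at hv
  have hne : 𝐱 ^ ℓ ≠ 0 := by
    intro h0
    have := toSkew_x_pow hq ℓ
    rw [h0, map_zero] at this
    exact one_ne_zero (single_eq_zero.1 this.symm)
  exact smul_left_injective k hne (by simpa using hv)

-- The anti-automorphism exchanging x and y reduces this to x, avoiding the non-unit coefficient T.
open MulOpposite in
theorem exists_eq_smul_y {ℓ : ℕ} (hℓ : ℓ ≠ 0) {v : QuantumHeisenberg (q : k)}
    (hv : v ^ ℓ = 𝐲 ^ ℓ) : ∃ r : k, r ^ ℓ = 1 ∧ v = r • 𝐲 := by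
  obtain ⟨r, hr, h⟩ := exists_eq_smul_x hq hℓ (v := unop (swap (q : k) v))
    (by rw [← unop_pow, ← map_pow, hv, map_pow, swap_y, unop_pow, unop_op])
  refine ⟨r, hr, ?_⟩
  rw [← unop_swap_unop_swap v, h]
  simp

theorem exists_eq_smul_z {ℓ : ℕ} (hℓ : ℓ ≠ 0) (hprim : IsPrimitiveRoot (q : k) ℓ)
    {v : QuantumHeisenberg (q : k)} (hv : v ^ ℓ = 𝐳 ^ ℓ) : ∃ r : k, r ^ ℓ = 1 ∧ v = r • 𝐳 := by
  have h : toSkew hq v ^ ℓ = single 1 (Coeff.Z q ^ ℓ) := by rw [← map_pow, hv, toSkew_z_pow]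
  obtain ⟨a, s, ha, hs⟩ := exists_eq_single_of_pow_eq_single hℓ
    (pow_ne_zero ℓ (Coeff.Z_ne_zero q)) h
  obtain rfl : a = 1 := pow_left_injective hℓ (by simpa using ha)
  have hsZ : s ^ ℓ = Coeff.Z q ^ ℓ := by
    apply single_injective (1 : Multiplicative ℤ)
    rw [← h, hs, ← toSkew_coeffHom hq, ← toSkew_coeffHom hq, ← map_pow, ← map_pow]
  have hprim' := hprim.map_of_injective (algebraMap k (Coeff q)).injective
  have : NeZero ℓ := ⟨hℓ⟩
  -- As k contains all ℓ-th roots of unity, s^ℓ - Z^ℓ splits into factors s - ζZ, one of which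
  -- vanishes.
  have hprod := hprim'.pow_sub_pow_eq_prod_sub_mul s (Coeff.Z q) (Nat.pos_of_ne_zero hℓ)
  rw [hsZ, sub_self, eq_comm, Finset.prod_eq_zero_iff] at hprod
  obtain ⟨ζ, hζ, hζs⟩ := hprod
  obtain ⟨i, -, rfl⟩ := hprim'.eq_pow_of_pow_eq_one
    ((Polynomial.mem_nthRootsFinset (Nat.pos_of_ne_zero hℓ) 1).1 hζ)
  refine ⟨(q : k) ^ i, by rw [← pow_mul, mul_comm, pow_mul, hprim.pow_eq_one, one_pow], ?_⟩
  apply toSkew_injective hq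
  rw [hs, map_smul, toSkew_z, smul_single, sub_eq_zero.1 hζs, ← map_pow, Algebra.smul_def]

end

end QuantumHeisenberg

/-! ### Central elements and the shape of ozone automorphisms -/

namespace QuantumHeisenberg

open SkewMonoidAlgebra Multiplicative

section

variable {k : Type*} [Field k] {q : kˣ}

local notation "𝐱" => gen (q : k) Gen.x
local notation "𝐲" => gen (q : k) Gen.y
local notation "𝐳" => gen (q : k) Gen.z

theorem weight_eq_one {n : ℤ} (hn : q ^ n = 1) : weight q n = 1 := by
  ext i; fin_cases i <;> simp [weight, hn]

theorem mem_center_of_commute_single (hq : (q : k) ^ 3 ≠ 1) {c : QuantumHeisenberg (q : k)}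
    (hc : ∀ a r, single a r * toSkew hq c = toSkew hq c * single a r) :
    c ∈ Subalgebra.center k (QuantumHeisenberg (q : k)) := by
  refine mem_center_of_forall_gen fun i => toSkew_injective hq ?_
  rw [map_mul, map_mul]
  cases i
  · rw [toSkew_x, hc]
  · rw [toSkew_y, hc]
  · rw [toSkew_z, hc]

theorem coeffHom_mem_center (hq : (q : k) ^ 3 ≠ 1) {f : Coeff q}
    (hf : ∀ a : Multiplicative ℤ, a • f = f) :
    coeffHom q f ∈ Subalgebra.center k (QuantumHeisenberg (q : k)) := by
  refine mem_center_of_commute_single hq fun a r => ?_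
  rw [toSkew_coeffHom, single_mul_single, single_mul_single, hf, one_smul, mul_one, one_mul,
    mul_comm]

theorem x_pow_mem_center (hq : (q : k) ^ 3 ≠ 1) {ℓ : ℕ} (hℓ : q ^ ℓ = 1) :
    𝐱 ^ ℓ ∈ Subalgebra.center k (QuantumHeisenberg (q : k)) := by
  refine mem_center_of_commute_single hq fun a r => ?_
  rw [toSkew_x_pow, single_mul_single, single_mul_single, ofAdd_smul,
    weight_eq_one (by simpa using hℓ), Coeff.scale_one, smul_one, mul_one, one_mul, mul_comm a]

open MulOpposite in
theorem y_pow_mem_center (hq : (q : k) ^ 3 ≠ 1) {ℓ : ℕ} (hℓ : q ^ ℓ = 1) :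
    𝐲 ^ ℓ ∈ Subalgebra.center k (QuantumHeisenberg (q : k)) := by
  simpa using unop_swap_mem_center (x_pow_mem_center hq hℓ)

theorem z_pow_mem_center (hq : (q : k) ^ 3 ≠ 1) {ℓ : ℕ} (hℓ : q ^ ℓ = 1) :
    𝐳 ^ ℓ ∈ Subalgebra.center k (QuantumHeisenberg (q : k)) := by
  rw [← coeffHom_Z, ← map_pow]
  refine coeffHom_mem_center hq fun a => ?_
  rw [smul_pow', smul_Z, smul_pow, ← Units.val_pow_eq_pow_val, ← zpow_natCast, zpow_comm,
    zpow_natCast, hℓ, one_zpow, Units.val_one, one_smul]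

/-- The weights q⁻¹ of Z and q of W cancel. -/
theorem z_mul_normalElt_mem_center (hq : (q : k) ^ 3 ≠ 1) :
    𝐳 * normalElt q ∈ Subalgebra.center k (QuantumHeisenberg (q : k)) := by
  rw [← coeffHom_Z, ← coeffHom_W, ← map_mul]
  refine coeffHom_mem_center hq fun a => ?_
  rw [smul_mul', smul_Z, smul_W, smul_mul_smul_comm, ← Units.val_mul, ← zpow_add]
  simp

theorem exists_of_mem_ozoneGroup (hq : (q : k) ^ 3 ≠ 1) {ℓ : ℕ} (hℓ : ℓ ≠ 0)
    (hprim : IsPrimitiveRoot (q : k) ℓ)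
    {σ : QuantumHeisenberg (q : k) ≃ₐ[k] QuantumHeisenberg (q : k)}
    (hσ : σ ∈ ozoneGroup k (QuantumHeisenberg (q : k))) :
    ∃ α β γ : k, α ^ ℓ = 1 ∧ γ ^ ℓ = 1 ∧ γ ^ 3 = 1 ∧ α * β = γ ^ 2 ∧
      σ 𝐱 = α • 𝐱 ∧ σ 𝐲 = β • 𝐲 ∧ σ 𝐳 = γ • 𝐳 := by
  have hqℓ : q ^ ℓ = 1 := Units.ext (by simpa using hprim.pow_eq_one)
  obtain ⟨α, hα, hx⟩ := exists_eq_smul_x hq hℓ (v := σ 𝐱)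
    (by rw [← map_pow]; exact hσ _ (x_pow_mem_center hq hqℓ))
  obtain ⟨β, hβ, hy⟩ := exists_eq_smul_y hq hℓ (v := σ 𝐲)
    (by rw [← map_pow]; exact hσ _ (y_pow_mem_center hq hqℓ))
  obtain ⟨γ, hγ, hz⟩ := exists_eq_smul_z hq hℓ hprim (v := σ 𝐳)
    (by rw [← map_pow]; exact hσ _ (z_pow_mem_center hq hqℓ))
  have hz2 : 𝐳 ^ 2 ≠ 0 := by
    intro h0
    have := toSkew_z_pow hq 2
    rw [h0, map_zero] at this
    exact pow_ne_zero 2 (Coeff.Z_ne_zero q) (single_eq_zero.1 this.symm)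
  have hαβ : α * β = γ ^ 2 := by
    have h := congrArg σ (gen_x_mul_gen_y (q : k))
    simp only [map_mul, map_add, map_smul, map_pow, hx, hy, hz, smul_mul_smul_comm, smul_pow] at h
    rw [gen_x_mul_gen_y, mul_comm β α, smul_add, smul_comm, add_right_inj] at h
    exact smul_left_injective k hz2 h
  have hγ3 : γ ^ 3 = 1 := by
    -- Both yx and z² scale by γ², as βα = γ².
    have hw : σ (normalElt q) = γ ^ 2 • normalElt q := by
      simp only [normalElt, map_mul, map_add, map_smul, map_pow, hx, hy, hz, smul_mul_smul_comm,
        smul_pow, mul_comm β α, hαβ, smul_add]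
      rw [smul_comm]
    have h := hσ _ (z_mul_normalElt_mem_center hq)
    rw [map_mul, hw, hz, smul_mul_smul_comm, ← pow_succ'] at h
    have hne : 𝐳 * normalElt q ≠ 0 := by
      rw [← coeffHom_Z, ← coeffHom_W, ← map_mul]
      intro h0
      have := toSkew_coeffHom hq (Coeff.Z q * Coeff.W q)
      rw [h0, map_zero] at this
      exact mul_ne_zero (Coeff.Z_ne_zero q) (Coeff.W_ne_zero q) (single_eq_zero.1 this.symm)
    exact smul_left_injective k hne (by simpa using h)
  exact ⟨α, β, γ, hα, hγ, hγ3, hαβ, hx, hy, hz⟩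

/-! ### Diagonal automorphisms and their action on the center -/

/-- The scalars `α`, `γ² α⁻¹`, `γ` by which a diagonal automorphism acts on the generators. -/
def diagScalar (p : kˣ × kˣ) : Gen → kˣ
  | .x => p.1
  | .y => p.2 ^ 2 * p.1⁻¹
  | .z => p.2

theorem diagScalar_one (i : Gen) : diagScalar (1 : kˣ × kˣ) i = 1 := by
  cases i <;> simp [diagScalar]

theorem diagScalar_mul (p r : kˣ × kˣ) (i : Gen) :
    diagScalar (p * r) i = diagScalar p i * diagScalar r i := by
  cases i
  · rfl
  · simp only [diagScalar, Prod.fst_mul, Prod.snd_mul, mul_pow, mul_inv]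
    exact mul_mul_mul_comm _ _ _ _
  · rfl

variable (q) in
/-- The diagonal endomorphism with given scalars. -/
noncomputable def diagAlgHom (p : kˣ × kˣ) :
    QuantumHeisenberg (q : k) →ₐ[k] QuantumHeisenberg (q : k) :=
  lift (fun i => (diagScalar p i : k) • gen (q : k) i)
    (by rw [smul_mul_smul_comm, smul_mul_smul_comm, gen_z_mul_gen_x, smul_comm, mul_comm])
    (by rw [smul_mul_smul_comm, smul_mul_smul_comm, gen_y_mul_gen_z, smul_comm, mul_comm])
    (by
      have h : (diagScalar p .x : k) * diagScalar p .y = (diagScalar p .z : k) ^ 2 := by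
        simp only [diagScalar, ← Units.val_mul, ← Units.val_pow_eq_pow_val]
        rw [mul_comm, inv_mul_cancel_right]
      rw [smul_mul_smul_comm, smul_mul_smul_comm, gen_x_mul_gen_y, smul_pow, mul_comm _ (_ : k),
        ← h, smul_add, smul_comm, mul_comm _ (diagScalar p .x : k)])

@[simp]
theorem diagAlgHom_gen (p : kˣ × kˣ) (i : Gen) :
    diagAlgHom q p (gen _ i) = (diagScalar p i : k) • gen (q : k) i := lift_gen _ _ _ _ _

variable (q) in
/-- The action of the torus on the quantum Heisenberg algebra by diagonal automorphisms. -/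
noncomputable def diag :
    kˣ × kˣ →* (QuantumHeisenberg (q : k) ≃ₐ[k] QuantumHeisenberg (q : k)) :=
  (AlgEquiv.algHomUnitsEquiv k (QuantumHeisenberg (q : k))).toMonoidHom.comp
    -- A monoid homomorphism out of a group lands in the units, so the endomorphisms are invertible.
    (MonoidHom.toHomUnits
      { toFun := diagAlgHom q
        map_one' := by
          refine algHom_ext fun i => ?_
          rw [diagAlgHom_gen, diagScalar_one, Units.val_one, one_smul, AlgHom.one_apply]
        map_mul' := fun p r => by
          refine algHom_ext fun i => ?_
          rw [AlgHom.mul_apply, diagAlgHom_gen, diagAlgHom_gen, map_smul, diagAlgHom_gen,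
            diagScalar_mul, smul_smul, Units.val_mul, mul_comm] })

theorem diag_apply (p : kˣ × kˣ) (h : QuantumHeisenberg (q : k)) :
    diag q p h = diagAlgHom q p h := rfl

/-- The scalars by which a diagonal automorphism acts on the variables `Z` and `W`. -/
def coeffScalar (γ : kˣ) : Fin 2 → k := ![(γ : k), (γ : k) ^ 2]

variable (q) in
/-- The extension of a diagonal automorphism to the skew Laurent polynomial ring. -/
noncomputable def diagSkew (p : kˣ × kˣ) : Skew q →ₐ[k] Skew q :=
  liftNCAlgHom
    (({ singleOneRingHom with commutes' := fun _ => rfl } : Coeff q →ₐ[k] Skew q).comp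
      (Coeff.scale (coeffScalar p.2)))
    { toFun := fun n => single n (algebraMap k (Coeff q) ((p.1 ^ n.toAdd : kˣ) : k))
      map_one' := by simp
      map_mul' := fun m n => by
        rw [single_mul_single, smul_algebraMap, ← map_mul, ← Units.val_mul, ← zpow_add, toAdd_mul] }
    (by
      intro f n
      have h : Coeff.scale (coeffScalar p.2) (n • f) = n • Coeff.scale (coeffScalar p.2) f := by
        change Coeff.scale _ (Coeff.scale _ f) = Coeff.scale _ (Coeff.scale _ f)
        rw [Coeff.scale_scale, Coeff.scale_scale, mul_comm]
      change single 1 (Coeff.scale _ (n • f)) * single n _ = single n _ * single 1 _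
      rw [single_mul_single, single_mul_single, one_mul, mul_one, one_smul, h, mul_comm]
      rfl)

theorem diagSkew_single (p : kˣ × kˣ) (n : Multiplicative ℤ) (f : Coeff q) :
    diagSkew q p (single n f) =
      single n (((p.1 ^ n.toAdd : kˣ) : k) • Coeff.scale (coeffScalar p.2) f) := by
  have : diagSkew q p (single n f) = single 1 (Coeff.scale (coeffScalar p.2) f) *
      single n (algebraMap k (Coeff q) ((p.1 ^ n.toAdd : kˣ) : k)) := liftNC_single _ _ _ _
  rw [this, single_mul_single, one_mul, one_smul, Algebra.smul_def, mul_comm]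

theorem diagSkew_coeff (p : kˣ × kˣ) (n : Multiplicative ℤ) (f : Skew q) :
    (diagSkew q p f).coeff n =
      ((p.1 ^ n.toAdd : kˣ) : k) • Coeff.scale (coeffScalar p.2) (f.coeff n) := by
  classical
  induction f using SkewMonoidAlgebra.induction_on' with
  | single m r =>
    rw [diagSkew_single, coeff_single_apply, coeff_single_apply]
    by_cases h : m = n
    · subst h; simp
    · simp [h]
  | add f g hf hg => rw [map_add, coeff_add, coeff_add, Finsupp.add_apply, Finsupp.add_apply, hf,
      hg, map_add, smul_add]

theorem toSkew_diagAlgHom (hq : (q : k) ^ 3 ≠ 1) (p : kˣ × kˣ) (h : QuantumHeisenberg (q : k)) :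
    toSkew hq (diagAlgHom q p h) = diagSkew q p (toSkew hq h) := by
  rw [← AlgHom.comp_apply, ← AlgHom.comp_apply]
  congr 1
  refine algHom_ext fun i => ?_
  rw [AlgHom.comp_apply, AlgHom.comp_apply, diagAlgHom_gen, map_smul]
  cases i
  · rw [toSkew_x, diagSkew_single, smul_single]
    simp [diagScalar]
  · rw [toSkew_y, diagSkew_single, smul_single]
    congr 1
    simp [diagScalar, Coeff.T, Coeff.scale_Z, Coeff.scale_W, coeffScalar, smul_pow, smul_sub,
      smul_smul]
    ring_nf
  · rw [toSkew_z, diagSkew_single, smul_single]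
    simp [diagScalar, Coeff.scale_Z, coeffScalar]

/-- Monomials are eigenvectors of both scalings, so it suffices to compare exponents on the support
of `f`. -/
theorem scaleVars_coeffScalar_eq_self {ℓ : ℕ} (hprim : IsPrimitiveRoot q ℓ) {γ : kˣ}
    (hγ : γ ^ ℓ = 1) (hγ3 : γ ^ 3 = 1) {f : MvPolynomial (Fin 2) k}
    (hf : MvPolynomial.scaleVars (weight q 1) f = f) :
    MvPolynomial.scaleVars (coeffScalar γ) f = f := by
  ext m
  rw [MvPolynomial.coeff_scaleVars]
  have h := congrArg (MvPolynomial.coeff m) hf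
  rw [MvPolynomial.coeff_scaleVars] at h
  by_cases hm : f.coeff m = 0
  · rw [hm, mul_zero]
  rw [mul_eq_right₀ hm, Finsupp.prod_fintype _ _ (by simp), Fin.prod_univ_two] at h ⊢
  have h' : q ^ ((m 1 : ℤ) - m 0) = 1 := by
    ext
    rw [sub_eq_neg_add, zpow_add, zpow_neg]
    simpa [weight] using h
  obtain ⟨j, hj⟩ := (hprim.zpow_eq_one_iff_dvd _).1 h'
  have hγm : γ ^ ((m 0 : ℤ) + 2 * m 1) = 1 := by
    have : (m 0 : ℤ) + 2 * m 1 = 3 * m 1 + ℓ * (-j) := by linarith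
    rw [this, zpow_add, zpow_mul, zpow_mul, zpow_natCast γ ℓ, hγ]
    simp only [one_zpow, mul_one]
    have : γ ^ (3 : ℤ) = 1 := by exact_mod_cast hγ3
    rw [this, one_zpow]
  have := congrArg (Units.val) hγm
  rw [zpow_add, zpow_mul] at this
  simpa [coeffScalar] using this

theorem diag_mem_ozoneGroup (hq : (q : k) ^ 3 ≠ 1) {ℓ : ℕ} (hprim : IsPrimitiveRoot q ℓ)
    {p : kˣ × kˣ} (h₁ : p.1 ^ ℓ = 1) (h₂ : p.2 ^ ℓ = 1) (h₃ : p.2 ^ 3 = 1) :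
    diag q p ∈ ozoneGroup k (QuantumHeisenberg (q : k)) := by
  intro c hc
  rw [Subalgebra.mem_center_iff] at hc
  apply toSkew_injective hq
  rw [diag_apply, toSkew_diagAlgHom]
  have hx := congrArg (toSkew hq) (hc 𝐱)
  have hz := congrArg (toSkew hq) (hc 𝐳)
  rw [map_mul, map_mul, toSkew_x] at hx
  rw [map_mul, map_mul, toSkew_z] at hz
  refine SkewMonoidAlgebra.ext fun n => ?_
  rw [diagSkew_coeff]
  set f := (toSkew hq c).coeff n with hf
  by_cases hf0 : f = 0
  · rw [hf0, map_zero, smul_zero]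
  -- Commuting with x makes each coefficient invariant under t; commuting with z forces q^n = 1 in
  -- every degree n that occurs.
  have hfx : ofAdd (1 : ℤ) • f = f := by
    have := congrArg (fun g => g.coeff (ofAdd 1 * n)) hx
    simpa only [coeff_single_mul, coeff_mul_single, smul_one, mul_one, one_mul,
      mul_comm (ofAdd (1 : ℤ)) n, mul_inv_cancel_right, mul_comm (ofAdd (1 : ℤ))⁻¹, ← hf] using this
  have hfz : q ^ n.toAdd = 1 := by
    have := congrArg (fun g => g.coeff n) hz
    simp only [coeff_single_one_mul, coeff_mul_single_one, ← hf] at this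
    rw [mul_comm] at this
    have := mul_left_cancel₀ hf0 this
    rw [smul_Z, eq_comm] at this
    have := smul_left_injective k (Coeff.Z_ne_zero q) (this.trans (one_smul k _).symm)
    ext
    simpa using this
  obtain ⟨j, hj⟩ := (hprim.zpow_eq_one_iff_dvd _).1 hfz
  rw [hj, zpow_mul, zpow_natCast, h₁, one_zpow, Units.val_one, one_smul]
  exact scaleVars_coeffScalar_eq_self hprim h₂ h₃ hfx

theorem diag_injective (hq : (q : k) ^ 3 ≠ 1) : Function.Injective (diag q) := by
  rw [injective_iff_map_eq_one]
  intro p hp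
  have hne (i : Gen) (hi : toSkew hq (gen _ i) ≠ 0) : diagScalar p i = 1 := by
    have h := AlgEquiv.congr_fun hp (gen _ i)
    rw [diag_apply, diagAlgHom_gen, AlgEquiv.one_apply] at h
    have h0 : gen (q : k) i ≠ 0 := fun h => hi (by rw [h, map_zero])
    have := smul_left_injective k h0 (h.trans (one_smul k _).symm)
    simpa using this
  refine Prod.ext (hne .x ?_) (hne .z ?_)
  · rw [toSkew_x]
    exact fun h => one_ne_zero (single_eq_zero.1 h)
  · rw [toSkew_z]
    exact fun h => Coeff.Z_ne_zero q (single_eq_zero.1 h)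

/-- The ozone group of the quantum Heisenberg algebra at a primitive `ℓ`-th root of unity. -/
theorem nonempty_ozoneGroup_mulEquiv (hq : (q : k) ^ 3 ≠ 1) {ℓ : ℕ} (hℓ : ℓ ≠ 0)
    (hprim : IsPrimitiveRoot q ℓ) :
    Nonempty (ozoneGroup k (QuantumHeisenberg (q : k)) ≃*
      rootsOfUnity ℓ k × rootsOfUnity (Nat.gcd ℓ 3) k) := by
  let ι : rootsOfUnity ℓ k × rootsOfUnity (Nat.gcd ℓ 3) k →* kˣ × kˣ :=
    (rootsOfUnity ℓ k).subtype.prodMap (rootsOfUnity (Nat.gcd ℓ 3) k).subtype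
  have hι : Function.Injective ι := Prod.map_injective.2
    ⟨Subtype.val_injective, Subtype.val_injective⟩
  have hmem (p) : (diag q).comp ι p ∈ ozoneGroup k (QuantumHeisenberg (q : k)) := by
    have h := (mem_rootsOfUnity _ _).1 p.2.2
    refine diag_mem_ozoneGroup hq hprim ((mem_rootsOfUnity _ _).1 p.1.2) ?_ ?_
    · exact orderOf_dvd_iff_pow_eq_one.1
        ((orderOf_dvd_of_pow_eq_one h).trans (Nat.gcd_dvd_left _ _))
    · exact orderOf_dvd_iff_pow_eq_one.1
        ((orderOf_dvd_of_pow_eq_one h).trans (Nat.gcd_dvd_right _ _))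
  refine ⟨(MulEquiv.ofBijective (((diag q).comp ι).codRestrict _ hmem) ⟨?_, ?_⟩).symm⟩
  · intro p r h
    exact hι (diag_injective hq (congrArg Subtype.val h))
  · rintro ⟨σ, hσ⟩
    obtain ⟨α, β, γ, hα, hγ, hγ3, hαβ, hx, hy, hz⟩ :=
      exists_of_mem_ozoneGroup hq hℓ (IsPrimitiveRoot.coe_units_iff.2 hprim) hσ
    obtain ⟨α, rfl⟩ := IsUnit.of_pow_eq_one hα hℓ
    obtain ⟨γ, rfl⟩ := IsUnit.of_pow_eq_one hγ hℓ
    have hβ : β = ((γ ^ 2 * α⁻¹ : kˣ) : k) := by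
      rw [Units.val_mul, Units.val_pow_eq_pow_val, ← hαβ, mul_comm (α : k), mul_assoc,
        Units.mul_inv, mul_one]
    refine ⟨⟨⟨α, Units.ext (by simpa using hα)⟩, ⟨γ, pow_gcd_eq_one.2 ⟨?_, ?_⟩⟩⟩, ?_⟩
    · exact Units.ext (by simpa using hγ)
    · exact Units.ext (by simpa using hγ3)
    · apply Subtype.ext
      apply AlgEquiv.coe_toAlgHom_injective
      refine algHom_ext fun i => ?_
      change diagAlgHom q (α, γ) (gen _ i) = σ (gen _ i)
      rw [diagAlgHom_gen]
      cases i
      · exact hx.symm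
      · rw [hy, hβ]
        rfl
      · exact hz.symm

end

theorem nonempty_rootsOfUnity_mulEquiv {k : Type*} [Field k] {ζ : k} {n : ℕ} [NeZero n]
    (h : IsPrimitiveRoot ζ n) : Nonempty (rootsOfUnity n k ≃* Multiplicative (ZMod n)) :=
  ⟨mulEquivOfCyclicCardEq (by simpa using h.card_rootsOfUnity)⟩

end QuantumHeisenberg

open QuantumHeisenberg in
theorem proposition1p4 {k : Type*} [Field k] [CharZero k] (q : k) (ℓ : ℕ)
    (hℓ : 2 ≤ ℓ) (hℓ3 : ℓ ≠ 3) (hq : IsPrimitiveRoot q ℓ) :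
    (¬ 3 ∣ ℓ →
      Nonempty (ozoneGroup k (QuantumHeisenberg q) ≃* Multiplicative (ZMod ℓ))) ∧
    (3 ∣ ℓ →
      Nonempty (ozoneGroup k (QuantumHeisenberg q) ≃*
        Multiplicative (ZMod ℓ) × Multiplicative (ZMod 3))) := by
  have hℓ0 : ℓ ≠ 0 := by omega
  have : NeZero ℓ := ⟨hℓ0⟩
  have hq3 : q ^ 3 ≠ 1 := by
    intro h
    -- Otherwise ℓ divides 3, so ℓ is 1 or 3, both excluded.
    rcases (Nat.dvd_prime Nat.prime_three).1 (hq.dvd_of_pow_eq_one 3 h) with h | h <;> omega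
  obtain ⟨e⟩ := nonempty_rootsOfUnity_mulEquiv hq
  have hu := hq.isUnit hℓ0
  obtain ⟨u, rfl⟩ := hu
  obtain ⟨f⟩ := nonempty_ozoneGroup_mulEquiv hq3 hℓ0 (IsPrimitiveRoot.coe_units_iff.1 hq)
  constructor
  · intro h3
    have hg : Nat.gcd ℓ 3 = 1 := ((Nat.Prime.coprime_iff_not_dvd Nat.prime_three).2 h3).symm
    have : Unique (rootsOfUnity (Nat.gcd ℓ 3) k) := by
      rw [hg, rootsOfUnity_one]
      infer_instance
    exact ⟨(f.trans MulEquiv.prodUnique).trans e⟩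
  · rintro h3
    rw [Nat.gcd_eq_right h3] at f
    -- The power q^(ℓ/3) is a primitive cube root of unity.
    obtain ⟨g⟩ := nonempty_rootsOfUnity_mulEquiv
      (hq.pow (Nat.pos_of_ne_zero hℓ0) (Nat.div_mul_cancel h3).symm)
    exact ⟨f.trans (e.prodCongr g)⟩
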